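/- **Algorithm.** Let $\lambda\ge 1$, $\varepsilon>0$ and $B\in\mathbb N$. For $\ell\in\mathbb N$ let $\mathcal I^\ell=\{[k2^\ell,(k+1)2^\ell-1] : k\in\mathbb N,\ k\ge 1\}$, let $\mathcal I=\bigcup_\ell \mathcal I^\ell$ and, for $t\ge1$, $\mathcal I_t=\{I\in\mathcal I : t\in I\}$. Let $(Z_I)_{I\in\mathcal I}$ be independent random variables, where for $I\in\mathcal I^\ell$ the variable $Z_I$ has the Laplace distribution centered at $0$ with scale $(1+\ell)^{1-\lambda}/\varepsilon$. The algorithm $\mathcal A=\mathcal A_{\lambda,B,\varepsilon}$ reads a stream $x_1,x_2,\dots$ of real numbers; at time $t\le B$ it outputs $\mathcal A_t(x)=0$, and at time $t>B$ it outputs $$\mathcal A_t(x)=\sum_{i=1}^{t-B}x_i+\sum_{I\in\mathcal I_{t-B}}Z_I .$$ **Privacy notion.** Let $g:\mathbb N\to\mathbb R_{\ge0}$ be non-decreasing. A randomized online algorithm $\mathcal A$ satisfies $\varepsilon$-differential privacy with expiration function $g$ if for all $\tau\ge1$, all measurable $S\subseteq\mathbb R^\tau$, all $1\le j\le\tau$,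 and all streams $x,x'$ that agree except possibly at time $j$, where $|x_j-x'_j|\le1$, $$\Pr[(\mathcal A_t(x))_{t=1}^\tau\in S]\le e^{g(\tau-j)\,\varepsilon}\,\Pr[(\mathcal A_t(x'))_{t=1}^\tau\in S].$$ **Corollary.** (Error.) For every constant $a$ in the choice $B=O(\log(T)/\varepsilon)$ and every constant $c>0$ there is a constant $K>0$, depending only on $a$ and $c$, such that for all $\lambda\ge1$, all $\varepsilon>0$, all integers $T\ge1$, all $B\in\mathbb N$ with $B\le a\log(T)/\varepsilon$, and every stream $x$ with $x_1,\dots,x_T\in[0,1]$, $$\Pr\Big[\max_{1\le t\le T}\Big|\mathcal A_t(x)-\sum_{i=1}^t x_i\Big|\le K\,\frac{\log T}{\varepsilon}\Big]\ \ge\ 1-\frac1{T^c}.$$ (Privacy.) For every $\lambda\ge1$ there is a constant $C>0$, depending only on $\lambda$, such that for all $\varepsilon>0$ and all $B\in\mathbb N$ (in particular for the above choice of $B$) the same algorithm $\mathcal A_{\lambda,B,\varepsilon}$ satisfies $\varepsilon$-differential privacy with the expiration function $$g(d)=\begin{cases}0 & \text{for } d<B,\\ C\,(1+\log^{\lambda}(d-B+1))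 & \text{for } d\ge B.\end{cases}$$ -/

import Mathlib

open MeasureTheory

noncomputable section

/-- Density of the Laplace distribution centered at `0` with scale `b`. -/
def laplacePDF (b : ℝ) (x : ℝ) : ℝ := 1 / (2 * b) * Real.exp (-|x| / b)

/-- The Laplace distribution `Lap(b)` centered at `0` with scale `b > 0`
(for `b ≤ 0`, which never occurs below, the point mass at `0`). -/
def laplace (b : ℝ) : Measure ℝ :=
  if 0 < b then volume.withDensity (fun x => ENNReal.ofReal (laplacePDF b x))
  else Measure.dirac 0

instance isProbabilityMeasure_laplace (b : ℝ) : IsProbabilityMeasure (laplace b) := by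
  unfold laplace
  split_ifs with hb
  · constructor
    rw [withDensity_apply _ MeasurableSet.univ, Measure.restrict_univ]
    have h1 : ∫ x : ℝ in Set.Ioi 0, 1 / (2 * b) * Real.exp (-x / b) = 1 / 2 := by
      have h := integral_exp_mul_Ioi (a := -(1 / b)) (by simpa using hb) 0
      rw [integral_const_mul]
      have e : (fun x : ℝ => Real.exp (-x / b)) = fun x => Real.exp (-(1 / b) * x) := by
        funext x; congr 1; ring
      rw [e, h]
      simp
      field_simp
    have h2 : ∫ x : ℝ, laplacePDF b x = 1 := by
      have := integral_comp_abs (f := fun x : ℝ => 1 / (2 * b) * Real.exp (-x / b))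
      unfold laplacePDF
      rw [this, h1]; norm_num
    have hint : Integrable (laplacePDF b) := by
      by_contra hcon
      rw [integral_undef hcon] at h2
      exact zero_ne_one h2
    rw [← ofReal_integral_eq_lintegral_ofReal hint
      (Filter.Eventually.of_forall fun x => by unfold laplacePDF; positivity), h2]
    simp
  · infer_instance

/-- A randomized online algorithm that reads a stream `x 1, x 2, …` of real numbers (the value
`x 0` is never read) and, with coin tosses `z : Ω`, outputs the real number `output x z t`
at time `t = 1, 2, …`; the output at time `t` depends only on `x 1, …, x t` and on the coins. -/
structure OnlineAlgorithm (Ω : Type*) [MeasurableSpace Ω] where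
  coins : Measure Ω
  isProbabilityMeasure_coins : IsProbabilityMeasure coins
  output : (ℕ → ℝ) → Ω → ℕ → ℝ
  measurable_output : ∀ x t, Measurable fun z => output x z t
  online : ∀ (x x' : ℕ → ℝ) (t : ℕ), (∀ i ∈ Finset.Icc 1 t, x i = x' i) →
    ∀ z, output x z t = output x' z t

/-- `ε`-differential privacy with expiration function `g : ℕ → ℝ≥0`, `g` non-decreasing.
The streams `x` and `Function.update x j y` differ only in the item of time `j`, by at most `1`;
what is compared is the law of the first `τ` outputs. -/
structure IsDPWithExpiration {Ω : Type*} [MeasurableSpace Ω] (A : OnlineAlgorithm Ω)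
    (ε : ℝ) (g : ℕ → ℝ) : Prop where
  nonneg : ∀ d, 0 ≤ g d
  mono : Monotone g
  private_le : ∀ (τ : ℕ) (x : ℕ → ℝ) (j : ℕ) (y : ℝ), 1 ≤ j → j ≤ τ → |x j - y| ≤ 1 →
    ∀ S : Set (Fin τ → ℝ), MeasurableSet S →
      A.coins {z | (fun i : Fin τ => A.output x z (i + 1)) ∈ S} ≤
        ENNReal.ofReal (Real.exp (g (τ - j) * ε)) *
          A.coins {z | (fun i : Fin τ => A.output (Function.update x j y) z (i + 1)) ∈ S}

/-- Index set of the dyadic interval set on `[1, ∞)`: the pair `(ℓ, k)` with `k ≥ 1` stands for the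
interval `[k 2^ℓ, (k + 1) 2^ℓ - 1]` of level `ℓ`; distinct pairs give distinct intervals. -/
abbrev DyadicInterval := ℕ × ℕ+

namespace DyadicInterval

def level (I : DyadicInterval) : ℕ := I.1

/-- The integers in the interval `[k 2^ℓ, (k + 1) 2^ℓ - 1]`. -/
def points (I : DyadicInterval) : Finset ℕ :=
  Finset.Icc ((I.2 : ℕ) * 2 ^ I.1) (((I.2 : ℕ) + 1) * 2 ^ I.1 - 1)

theorem finite_containing (t : ℕ) : {I : DyadicInterval | t ∈ I.points}.Finite := by
  refine Set.Finite.subset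
    ((Finset.range (t + 1) ×ˢ Finset.Icc 1 (Nat.succPNat t)).finite_toSet) ?_
  rintro ⟨l, k⟩ h
  simp only [points, Set.mem_ofPred_eq, Finset.mem_Icc] at h
  have hk : 1 ≤ (k : ℕ) := k.2
  have h2 : l < 2 ^ l := Nat.lt_two_pow_self
  have h3 : 2 ^ l ≤ (k : ℕ) * 2 ^ l := Nat.le_mul_of_pos_left _ hk
  have h4 : (k : ℕ) ≤ (k : ℕ) * 2 ^ l := Nat.le_mul_of_pos_right _ (by positivity)
  simp only [Finset.coe_product, Set.mem_prod, Finset.mem_coe, Finset.mem_range, Finset.mem_Icc]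
  refine ⟨by omega, one_le, ?_⟩
  rw [← PNat.coe_le_coe, Nat.succPNat_coe]
  omega

/-- The set `I_t` of all dyadic intervals that contain `t`. -/
def containing (t : ℕ) : Finset DyadicInterval := (finite_containing t).toFinset

end DyadicInterval

/-- The law of the noise: independent `Z_I ~ Lap((1 + ℓ)^(1 - λ) / ε)`, for every dyadic
interval `I`, where `ℓ` is the level of `I`. -/
def noiseLaw (lam ε : ℝ) : Measure (DyadicInterval → ℝ) :=
  Measure.infinitePi fun I => laplace ((1 + (I.level : ℝ)) ^ (1 - lam) / ε)

/-- The continual counting algorithm with delay `B`: it outputs `0` at the times `t ≤ B`, and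
`∑_{i ≤ t - B} x_i + ∑_{I ∋ t - B} Z_I` at the times `t > B`. -/
def countingAlgorithm (lam : ℝ) (B : ℕ) (ε : ℝ) : OnlineAlgorithm (DyadicInterval → ℝ) where
  coins := noiseLaw lam ε
  isProbabilityMeasure_coins := by unfold noiseLaw; infer_instance
  output x z t :=
    if t ≤ B then 0
    else ∑ i ∈ Finset.Icc 1 (t - B), x i + ∑ I ∈ DyadicInterval.containing (t - B), z I
  measurable_output x t := by
    split_ifs
    · exact measurable_const
    · fun_prop
  online x x' t h z := by
    have hs : ∑ i ∈ Finset.Icc 1 (t - B), x i = ∑ i ∈ Finset.Icc 1 (t - B), x' i :=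
      Finset.sum_congr rfl fun i hi => h i (by rw [Finset.mem_Icc] at hi ⊢; omega)
    rw [hs]

/-- The expiration function with value `0` for `d < B` and `C (1 + log^λ (d - B + 1))`
for `d ≥ B`. -/
def expirationFn (C lam : ℝ) (B : ℕ) (d : ℕ) : ℝ :=
  if d < B then 0 else C * (1 + Real.log ((d : ℝ) - (B : ℝ) + 1) ^ lam)

end

/-! Privacy is a coupling. Replacing `x j` by `y` moves by `δ = y - x j` exactly the prefix sums
ending at or after `j`, and the outputs up to time `τ` see only prefixes up to `τ - B`. Partition
`[j, τ - B]` into a set `D` of dyadic intervals: adding `δ` to `Z_I` for `I ∈ D` changes the outputs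
on the old stream into those on the new one (`output_update_eq_output_shift`). This shift costs a
factor `exp (ε ∑_{I ∈ D} (1 + ℓ)^(λ - 1))` (`noiseLaw_le_exp_mul_shift`). As `D` needs at most two
intervals per level (`exists_partitions_block`), the sum is `O(1 + log^λ (d - B + 1))` with `d = τ -
j`; for `d < B` the block is empty.

For the error, the delay loses at most `B`, and each noise sum has at most `log₂ T + 1` independent
terms of scale at most `1 / ε`. A Chernoff bound at rate `ε / 2` and a union bound over the times
finish. -/

/-! ### Laplace distribution: translation and exponential moment. -/

theorem measurable_laplacePDF (b : ℝ) : Measurable (laplacePDF b) := by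
  unfold laplacePDF
  fun_prop

theorem lintegral_laplace {b : ℝ} (hb : 0 < b) {f : ℝ → ENNReal} (hf : Measurable f) :
    ∫⁻ x, f x ∂laplace b = ∫⁻ x, ENNReal.ofReal (laplacePDF b x) * f x := by
  rw [laplace, if_pos hb, lintegral_withDensity_eq_lintegral_mul _
    (measurable_laplacePDF b).ennreal_ofReal hf]
  rfl

theorem laplacePDF_le_exp_mul_laplacePDF_sub {b : ℝ} (hb : 0 < b) (δ x : ℝ) :
    laplacePDF b x ≤ Real.exp (|δ| / b) * laplacePDF b (x - δ) := by
  have h : Real.exp (-|x| / b) ≤ Real.exp (|δ| / b) * Real.exp (-|x - δ| / b) := by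
    rw [← Real.exp_add, Real.exp_le_exp, ← add_div]
    gcongr
    have := abs_sub x δ
    linarith
  unfold laplacePDF
  calc 1 / (2 * b) * Real.exp (-|x| / b)
      ≤ 1 / (2 * b) * (Real.exp (|δ| / b) * Real.exp (-|x - δ| / b)) := by gcongr
    _ = _ := by ring

theorem laplace_le_exp_mul_preimage_add {b : ℝ} (hb : 0 < b) (δ : ℝ) {S : Set ℝ}
    (hS : MeasurableSet S) :
    laplace b S ≤ ENNReal.ofReal (Real.exp (|δ| / b)) * laplace b ((· + δ) ⁻¹' S) := by
  have hS' : MeasurableSet ((· + δ) ⁻¹' S) := measurable_add_const δ hS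
  rw [← lintegral_indicator_one hS, ← lintegral_indicator_one hS', lintegral_laplace hb (measurable_one.indicator hS),
    lintegral_laplace hb (measurable_one.indicator hS'),
    ← lintegral_sub_right_eq_self (fun x => ENNReal.ofReal (laplacePDF b x) *
      ((· + δ) ⁻¹' S).indicator 1 x) δ, ← lintegral_const_mul' _ _ ENNReal.ofReal_ne_top]
  refine lintegral_mono fun x => ?_
  have h1 : ((· + δ) ⁻¹' S).indicator (1 : ℝ → ENNReal) (x - δ) = S.indicator 1 x := by
    change S.indicator (1 : ℝ → ENNReal) (x - δ + δ) = _
    rw [sub_add_cancel]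
  rw [h1, ← mul_assoc, ← ENNReal.ofReal_mul (Real.exp_pos _).le]
  gcongr
  exact laplacePDF_le_exp_mul_laplacePDF_sub hb δ x

/-- At these rates the tilted density is at most twice the density of `Lap(2b)`. -/
theorem lintegral_exp_mul_abs_laplace_le {b s : ℝ} (hb : 0 < b) (hs : s ≤ 1 / (2 * b)) :
    ∫⁻ x, ENNReal.ofReal (Real.exp (s * |x|)) ∂laplace b ≤ 2 := by
  have h1 : ∫⁻ x, ENNReal.ofReal (laplacePDF (2 * b) x) = 1 := by
    have h := lintegral_laplace (b := 2 * b) (by positivity) (f := fun _ => 1) measurable_const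
    simpa using h.symm
  rw [lintegral_laplace hb (by fun_prop)]
  calc ∫⁻ x, ENNReal.ofReal (laplacePDF b x) * ENNReal.ofReal (Real.exp (s * |x|))
      ≤ ∫⁻ x, 2 * ENNReal.ofReal (laplacePDF (2 * b) x) := by
        refine lintegral_mono fun x => ?_
        have h0 : 0 ≤ laplacePDF b x := by unfold laplacePDF; positivity
        rw [← ENNReal.ofReal_mul h0, ← ENNReal.ofReal_ofNat 2, ← ENNReal.ofReal_mul (by norm_num)]
        refine ENNReal.ofReal_le_ofReal ?_
        have h2 : Real.exp (-|x| / b) * Real.exp (s * |x|) ≤ Real.exp (-|x| / (2 * b)) := by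
          rw [← Real.exp_add, Real.exp_le_exp]
          have h3 := mul_le_mul_of_nonneg_right hs (abs_nonneg x)
          have h4 : -|x| / (2 * b) = -|x| / b + 1 / (2 * b) * |x| := by field_simp; ring
          linarith
        unfold laplacePDF
        calc 1 / (2 * b) * Real.exp (-|x| / b) * Real.exp (s * |x|)
            = 1 / (2 * b) * (Real.exp (-|x| / b) * Real.exp (s * |x|)) := by ring
          _ ≤ 1 / (2 * b) * Real.exp (-|x| / (2 * b)) := by gcongr
          _ = _ := by field_simp
    _ = 2 := by
        rw [lintegral_const_mul _ (measurable_laplacePDF _).ennreal_ofReal, h1, mul_one]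

/-! ### Translating finitely many coordinates of an infinite product measure. -/

/-- Provides Fubini in one coordinate. It suffices to test finite boxes, where the resampled
coordinate contributes its own factor or is unconstrained. -/
theorem map_update_prod_infinitePi {ι : Type*} [DecidableEq ι] {X : ι → Type*}
    [∀ i, MeasurableSpace (X i)] (μ : ∀ i, Measure (X i)) [∀ i, IsProbabilityMeasure (μ i)]
    (i : ι) :
    ((μ i).prod (Measure.infinitePi μ)).map (fun p => Function.update p.2 i p.1) =
      Measure.infinitePi μ := by
  have hmeas : Measurable fun p : X i × (∀ j, X j) => Function.update p.2 i p.1 :=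
    measurable_update'.comp measurable_swap
  refine Measure.eq_infinitePi _ fun s t ht => ?_
  rw [Measure.map_apply hmeas (MeasurableSet.pi s.countable_toSet fun j _ => ht j)]
  have hpre : (fun p : X i × (∀ j, X j) => Function.update p.2 i p.1) ⁻¹' (s : Set ι).pi t =
      (if i ∈ s then t i else Set.univ) ×ˢ ((s.erase i : Finset ι) : Set ι).pi t := by
    ext p
    simp only [Set.mem_preimage, Set.mem_pi, Set.mem_prod, Finset.mem_coe, Finset.mem_erase]
    constructor
    · intro h
      refine ⟨?_, fun j hj => by simpa [Function.update_of_ne hj.1] using h j hj.2⟩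
      split_ifs with hi
      · simpa using h i hi
      · trivial
    · rintro ⟨h1, h2⟩ j hj
      by_cases hji : j = i
      · subst hji
        simpa [hj] using h1
      · simpa [Function.update_of_ne hji] using h2 j ⟨hji, hj⟩
  rw [hpre, Measure.prod_prod, Measure.infinitePi_pi μ (fun j _ => ht j)]
  split_ifs with hi
  · exact Finset.mul_prod_erase s (fun j => μ j (t j)) hi
  · rw [measure_univ, one_mul, Finset.erase_eq_of_notMem hi]

theorem infinitePi_apply_eq_lintegral_update {ι : Type*} [DecidableEq ι] {X : ι → Type*}
    [∀ i, MeasurableSpace (X i)] (μ : ∀ i, Measure (X i)) [∀ i, IsProbabilityMeasure (μ i)]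
    (i : ι) {E : Set (∀ i, X i)} (hE : MeasurableSet E) :
    Measure.infinitePi μ E =
      ∫⁻ z, μ i {x | Function.update z i x ∈ E} ∂Measure.infinitePi μ := by
  have hmeas : Measurable fun p : X i × (∀ j, X j) => Function.update p.2 i p.1 :=
    measurable_update'.comp measurable_swap
  conv_lhs => rw [← map_update_prod_infinitePi μ i]
  rw [Measure.map_apply hmeas hE, Measure.prod_apply_symm (hmeas hE)]
  rfl

/-- The one-dimensional bound applies to each slice with the other coordinates fixed. -/
theorem infinitePi_le_mul_update_add {ι : Type*} [DecidableEq ι] (μ : ι → Measure ℝ)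
    [∀ i, IsProbabilityMeasure (μ i)] (i : ι) (δ : ℝ) (c : ENNReal) (hc : c ≠ ⊤)
    (h : ∀ S, MeasurableSet S → μ i S ≤ c * μ i ((· + δ) ⁻¹' S))
    {E : Set (ι → ℝ)} (hE : MeasurableSet E) :
    Measure.infinitePi μ E ≤
      c * Measure.infinitePi μ {z | Function.update z i (z i + δ) ∈ E} := by
  have hshift : Measurable fun z : ι → ℝ => Function.update z i (z i + δ) :=
    measurable_update'.comp
      (measurable_id.prodMk (Measurable.add_const
        (measurable_pi_apply i : Measurable fun z : ι → ℝ => z i) δ))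
  have hE' : MeasurableSet {z : ι → ℝ | Function.update z i (z i + δ) ∈ E} := hshift hE
  rw [infinitePi_apply_eq_lintegral_update μ i hE,
    infinitePi_apply_eq_lintegral_update μ i hE', ← lintegral_const_mul' _ _ hc]
  refine lintegral_mono fun z => (h _ (measurable_update z hE)).trans_eq ?_
  congr 2
  ext x
  simp

theorem infinitePi_le_prod_mul_shift {ι : Type*} [DecidableEq ι] (μ : ι → Measure ℝ)
    [∀ i, IsProbabilityMeasure (μ i)] (δ : ℝ) (c : ι → ENNReal) (hc : ∀ i, c i ≠ ⊤)
    (h : ∀ i S, MeasurableSet S → μ i S ≤ c i * μ i ((· + δ) ⁻¹' S)) (D : Finset ι)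
    {E : Set (ι → ℝ)} (hE : MeasurableSet E) :
    Measure.infinitePi μ E ≤
      (∏ i ∈ D, c i) *
        Measure.infinitePi μ {z | (fun i => if i ∈ D then z i + δ else z i) ∈ E} := by
  induction D using Finset.induction_on with
  | empty => simp only [Finset.prod_empty, one_mul, Finset.notMem_empty, if_false]; rfl
  | insert a D ha ih =>
    have hshift : Measurable fun z : ι → ℝ => fun i => if i ∈ D then z i + δ else z i := by
      refine measurable_pi_lambda _ fun j => ?_
      split_ifs <;> fun_prop
    rw [Finset.prod_insert ha, mul_comm (c a), mul_assoc]
    refine ih.trans (mul_le_mul_right ?_ _)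
    refine (infinitePi_le_mul_update_add μ a δ (c a) (hc a) (h a) (hshift hE)).trans_eq ?_
    congr 2
    ext z
    simp only [Set.mem_preimage, Set.mem_ofPred_eq]
    congr! 1
    ext i
    by_cases hi : i = a
    · subst hi
      simp [ha]
    · simp [hi]

/-! ### Dyadic intervals: how many contain a point, and partitions of blocks. -/

namespace DyadicInterval

theorem mem_containing {t : ℕ} {I : DyadicInterval} : I ∈ containing t ↔ t ∈ I.points := by
  simp [containing]

theorem mem_points_iff {t : ℕ} {I : DyadicInterval} :
    t ∈ I.points ↔ (I.2 : ℕ) * 2 ^ I.1 ≤ t ∧ t < ((I.2 : ℕ) + 1) * 2 ^ I.1 := by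
  have : 0 < ((I.2 : ℕ) + 1) * 2 ^ I.1 := by positivity
  rw [points, Finset.mem_Icc]
  omega

/-- Intervals of one level are disjoint, and since `k ≥ 1` those of level `l` start no earlier than
`2 ^ l`. -/
theorem card_containing_le (t : ℕ) : (containing t).card ≤ Nat.log 2 t + 1 := by
  have hinj : Set.InjOn (fun I : DyadicInterval => I.1) (containing t) := by
    rintro ⟨l, k⟩ hI ⟨l', k'⟩ hI' h
    simp only [Finset.mem_coe, mem_containing, mem_points_iff] at hI hI'
    obtain rfl : l = l' := h
    have h1 : (k : ℕ) < k' + 1 := lt_of_mul_lt_mul_right (hI.1.trans_lt hI'.2) (Nat.zero_le _)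
    have h2 : (k' : ℕ) < k + 1 := lt_of_mul_lt_mul_right (hI'.1.trans_lt hI.2) (Nat.zero_le _)
    have : k = k' := PNat.coe_injective (by omega)
    rw [this]
  rw [← Finset.card_image_of_injOn hinj]
  refine (Finset.card_le_card (t := Finset.range (Nat.log 2 t + 1)) ?_).trans
    (Finset.card_range _).le
  intro l hl
  obtain ⟨I, hI, rfl⟩ := Finset.mem_image.1 hl
  rw [mem_containing, mem_points_iff] at hI
  refine Finset.mem_range.2 (Nat.lt_succ_of_le (Nat.le_log_of_pow_le (by norm_num) ?_))
  exact (Nat.le_mul_of_pos_left _ I.2.pos).trans hI.1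

/-- The intervals in `D` are disjoint with union the half-open block `[p, q)`. -/
def Partitions (D : Finset DyadicInterval) (p q : ℕ) : Prop :=
  ∀ t, (D ∩ containing t).card = if p ≤ t ∧ t < q then 1 else 0

theorem card_insert_inter_containing {D : Finset DyadicInterval} {I : DyadicInterval}
    (hI : I ∉ D) (t : ℕ) :
    (insert I D ∩ containing t).card =
      (D ∩ containing t).card + if t ∈ I.points then 1 else 0 := by
  split_ifs with h
  · rw [Finset.insert_inter_of_mem (mem_containing.2 h), Finset.card_insert_of_notMem]
    simp [hI]
  · rw [Finset.insert_inter_of_notMem (mt mem_containing.1 h), add_zero]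

theorem Partitions.notMem {D : Finset DyadicInterval} {p q t : ℕ} (h : Partitions D p q)
    (ht : ¬(p ≤ t ∧ t < q)) {I : DyadicInterval} (hI : t ∈ I.points) : I ∉ D := by
  intro hID
  have h0 := h t
  rw [if_neg ht, Finset.card_eq_zero] at h0
  have hmem : I ∈ D ∩ containing t := Finset.mem_inter.2 ⟨hID, mem_containing.2 hI⟩
  rw [h0] at hmem
  exact Finset.notMem_empty _ hmem

theorem Partitions.exists_extend_left {D : Finset DyadicInterval} {l a q : ℕ} (ha : 1 ≤ a)
    (h : Partitions D ((a + 1) * 2 ^ l) q) (hq : (a + 1) * 2 ^ l ≤ q) (w : ℕ → ℝ) :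
    ∃ D' : Finset DyadicInterval, Partitions D' (a * 2 ^ l) q ∧
      ∑ I ∈ D', w I.level = w l + ∑ I ∈ D, w I.level := by
  have hlt : a * 2 ^ l < (a + 1) * 2 ^ l := by gcongr; omega
  let I : DyadicInterval := (l, ⟨a, ha⟩)
  have hpts : ∀ t, t ∈ I.points ↔ a * 2 ^ l ≤ t ∧ t < (a + 1) * 2 ^ l := fun t => mem_points_iff
  have hI : I ∉ D := h.notMem (t := a * 2 ^ l) (by omega) ((hpts _).2 ⟨le_rfl, hlt⟩)
  refine ⟨insert I D, fun t => ?_, Finset.sum_insert hI⟩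
  rw [card_insert_inter_containing hI, h t]
  simp only [hpts]
  split_ifs <;> omega

theorem Partitions.exists_extend_right {D : Finset DyadicInterval} {l b p : ℕ} (hb : 1 ≤ b)
    (h : Partitions D p (b * 2 ^ l)) (hp : p ≤ b * 2 ^ l) (w : ℕ → ℝ) :
    ∃ D' : Finset DyadicInterval, Partitions D' p ((b + 1) * 2 ^ l) ∧
      ∑ I ∈ D', w I.level = w l + ∑ I ∈ D, w I.level := by
  have hlt : b * 2 ^ l < (b + 1) * 2 ^ l := by gcongr; omega
  let I : DyadicInterval := (l, ⟨b, hb⟩)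
  have hpts : ∀ t, t ∈ I.points ↔ b * 2 ^ l ≤ t ∧ t < (b + 1) * 2 ^ l := fun t => mem_points_iff
  have hI : I ∉ D := h.notMem (t := b * 2 ^ l) (by omega) ((hpts _).2 ⟨le_rfl, hlt⟩)
  refine ⟨insert I D, fun t => ?_, Finset.sum_insert hI⟩
  rw [card_insert_inter_containing hI, h t]
  simp only [hpts]
  split_ifs <;> omega

theorem partitions_empty (p : ℕ) : Partitions ∅ p p := by
  intro t
  rw [if_neg (by omega), Finset.empty_inter, Finset.card_empty]

/-- A block `[a 2^l, b 2^l)` with `b - a < 2^n` is partitioned by dyadic intervals, at most two of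
each of the levels `l, …, l + n - 1`. -/
theorem exists_partitions_block (w : ℕ → ℝ) (hw : ∀ l, 0 ≤ w l) (n : ℕ) :
    ∀ l a b : ℕ, 1 ≤ a → a ≤ b → b - a < 2 ^ n → ∃ D : Finset DyadicInterval,
      Partitions D (a * 2 ^ l) (b * 2 ^ l) ∧
        ∑ I ∈ D, w I.level ≤ 2 * ∑ i ∈ Finset.range n, w (l + i) := by
  induction n with
  | zero =>
    intro l a b _ hab hlt
    obtain rfl : a = b := by simp at hlt; omega
    exact ⟨∅, partitions_empty _, by simp⟩
  | succ n ih =>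
    intro l a b ha hab hlt
    -- The empty block is set apart: for odd `a = b`, rounding inward would make the ends cross.
    rcases hab.eq_or_lt with rfl | hab'
    · exact ⟨∅, partitions_empty _, by simpa using Finset.sum_nonneg fun i _ => hw (l + i)⟩
    -- Round both ends inward to even multiples of `2 ^ l`, which gives a block of level `l + 1`;
    -- each odd end then costs one interval of level `l`.
    obtain ⟨D, hD, hDw⟩ := ih (l + 1) ((a + 1) / 2) (b / 2) (by omega) (by omega)
      (by rw [pow_succ] at hlt; omega)
    have hpow (c : ℕ) : c * 2 ^ (l + 1) = 2 * c * 2 ^ l := by ring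
    rw [hpow, hpow] at hD
    have hsum : ∑ i ∈ Finset.range (n + 1), w (l + i) =
        w l + ∑ i ∈ Finset.range n, w (l + 1 + i) := by
      rw [Finset.sum_range_succ', add_comm, add_zero]
      simp only [add_assoc, add_comm 1]
    have hle : 2 * ((a + 1) / 2) * 2 ^ l ≤ 2 * (b / 2) * 2 ^ l := by gcongr; omega
    obtain ⟨D₁, hD₁, hw₁⟩ : ∃ D' : Finset DyadicInterval,
        Partitions D' (a * 2 ^ l) (2 * (b / 2) * 2 ^ l) ∧
          ∑ I ∈ D', w I.level ≤ w l + ∑ I ∈ D, w I.level := by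
      rcases Nat.even_or_odd' a with ⟨c, rfl | rfl⟩
      · rw [show (2 * c + 1) / 2 = c by omega] at hD
        exact ⟨D, hD, le_add_of_nonneg_left (hw l)⟩
      · rw [show 2 * ((2 * c + 1 + 1) / 2) = 2 * c + 1 + 1 by omega] at hD hle
        obtain ⟨D', h1, h2⟩ := hD.exists_extend_left ha hle w
        exact ⟨D', h1, h2.le⟩
    obtain ⟨D₂, hD₂, hw₂⟩ : ∃ D' : Finset DyadicInterval,
        Partitions D' (a * 2 ^ l) (b * 2 ^ l) ∧
          ∑ I ∈ D', w I.level ≤ w l + ∑ I ∈ D₁, w I.level := by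
      rcases Nat.even_or_odd' b with ⟨c, rfl | rfl⟩
      · rw [show 2 * c / 2 = c by omega] at hD₁
        exact ⟨D₁, hD₁, le_add_of_nonneg_left (hw l)⟩
      · rw [show (2 * c + 1) / 2 = c by omega] at hD₁
        obtain ⟨D', h1, h2⟩ := hD₁.exists_extend_right (by omega)
          (Nat.mul_le_mul_right _ (by omega)) w
        exact ⟨D', h1, h2.le⟩
    exact ⟨D₂, hD₂, by rw [hsum]; linarith⟩

end DyadicInterval

/-! ### Privacy. -/

theorem inv_noise_scale (lam ε : ℝ) (l : ℕ) :
    1 / ((1 + (l : ℝ)) ^ (1 - lam) / ε) = ε * (1 + (l : ℝ)) ^ (lam - 1) := by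
  have h : (0 : ℝ) < 1 + l := by positivity
  rw [show lam - 1 = -(1 - lam) by ring, Real.rpow_neg h.le]
  field_simp

/-- Each of the `n = log₂ N + 1` terms is at most `n ^ (lam - 1)`, and `n ≤ (2 / log 2) * max 1 (log
N)`. -/
theorem sum_range_rpow_le {lam : ℝ} (hlam : 1 ≤ lam) (N : ℕ) :
    2 * ∑ i ∈ Finset.range (Nat.log 2 N + 1), (1 + (i : ℝ)) ^ (lam - 1) ≤
      2 * (2 * (Real.log 2)⁻¹) ^ lam * (1 + Real.log N ^ lam) := by
  set n := Nat.log 2 N + 1 with hn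
  have hlog2 : 0 < Real.log 2 := Real.log_pos (by norm_num)
  have hinv : 1 ≤ (Real.log 2)⁻¹ :=
    (one_le_inv₀ hlog2).2 (by linarith [Real.log_two_lt_d9])
  have hL : 0 ≤ Real.log N := Real.log_natCast_nonneg N
  have hnpos : (0 : ℝ) < n := by positivity
  have h1 : ∑ i ∈ Finset.range n, (1 + (i : ℝ)) ^ (lam - 1) ≤ (n : ℝ) ^ lam := by
    calc ∑ i ∈ Finset.range n, (1 + (i : ℝ)) ^ (lam - 1)
        ≤ ∑ _i ∈ Finset.range n, (n : ℝ) ^ (lam - 1) := by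
          refine Finset.sum_le_sum fun i hi => ?_
          have : i + 1 ≤ n := Finset.mem_range.1 hi
          refine Real.rpow_le_rpow (by positivity) ?_ (by linarith)
          rw [add_comm]
          exact_mod_cast this
      _ = (n : ℝ) ^ lam := by
          rw [Finset.sum_const, Finset.card_range, nsmul_eq_mul, Real.rpow_sub_one hnpos.ne']
          field_simp
  have h2 : (n : ℝ) ≤ 2 * (Real.log 2)⁻¹ * max 1 (Real.log N) := by
    have h3 : (Nat.log 2 N : ℝ) ≤ Real.log N * (Real.log 2)⁻¹ := by
      have := Real.natLog_le_logb N 2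
      rwa [Real.logb, div_eq_mul_inv] at this
    have h4 : Real.log N * (Real.log 2)⁻¹ ≤ max 1 (Real.log N) * (Real.log 2)⁻¹ := by
      gcongr
      exact le_max_right _ _
    have h5 : 1 ≤ max 1 (Real.log N) * (Real.log 2)⁻¹ :=
      one_le_mul_of_one_le_of_one_le (le_max_left _ _) hinv
    rw [hn]
    push_cast
    linarith
  have h6 : max 1 (Real.log N) ^ lam ≤ 1 + Real.log N ^ lam := by
    rcases max_cases 1 (Real.log N) with ⟨h, _⟩ | ⟨h, _⟩ <;> rw [h]
    · rw [Real.one_rpow]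
      linarith [Real.rpow_nonneg hL lam]
    · linarith
  have h7 : (n : ℝ) ^ lam ≤ (2 * (Real.log 2)⁻¹) ^ lam * (1 + Real.log N ^ lam) :=
    calc (n : ℝ) ^ lam ≤ (2 * (Real.log 2)⁻¹ * max 1 (Real.log N)) ^ lam :=
          Real.rpow_le_rpow hnpos.le h2 (by linarith)
      _ = (2 * (Real.log 2)⁻¹) ^ lam * max 1 (Real.log N) ^ lam :=
          Real.mul_rpow (by positivity) (by positivity)
      _ ≤ _ := by gcongr
  linarith

theorem log_delay_nonneg {B d : ℕ} (h : B ≤ d) : 0 ≤ Real.log ((d : ℝ) - B + 1) := by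
  have : (B : ℝ) ≤ d := by exact_mod_cast h
  exact Real.log_nonneg (by linarith)

theorem expirationFn_nonneg {C : ℝ} (hC : 0 ≤ C) (lam : ℝ) (B d : ℕ) :
    0 ≤ expirationFn C lam B d := by
  unfold expirationFn
  split_ifs with h
  · exact le_rfl
  · have := Real.rpow_nonneg (log_delay_nonneg (not_lt.1 h)) lam
    positivity

theorem expirationFn_monotone {C lam : ℝ} (hC : 0 ≤ C) (hlam : 0 ≤ lam) (B : ℕ) :
    Monotone (expirationFn C lam B) := by
  intro d e hde
  by_cases h : d < B
  · rw [expirationFn, if_pos h]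
    exact expirationFn_nonneg hC lam B e
  · have hd : (B : ℝ) ≤ d := by exact_mod_cast not_lt.1 h
    have hde' : (d : ℝ) ≤ e := by exact_mod_cast hde
    rw [expirationFn, if_neg h, expirationFn, if_neg (by omega)]
    have h1 : Real.log ((d : ℝ) - B + 1) ≤ Real.log ((e : ℝ) - B + 1) :=
      Real.log_le_log (by linarith) (by linarith)
    have h2 := Real.rpow_le_rpow (log_delay_nonneg (not_lt.1 h)) h1 hlam
    gcongr

theorem noiseLaw_le_exp_mul_shift {ε : ℝ} (hε : 0 < ε) (lam : ℝ) {δ : ℝ} (hδ : |δ| ≤ 1)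
    (D : Finset DyadicInterval) {E : Set (DyadicInterval → ℝ)} (hE : MeasurableSet E) :
    noiseLaw lam ε E ≤
      ENNReal.ofReal (Real.exp ((∑ I ∈ D, (1 + (I.level : ℝ)) ^ (lam - 1)) * ε)) *
        noiseLaw lam ε {z | (fun I => if I ∈ D then z I + δ else z I) ∈ E} := by
  have hb (I : DyadicInterval) : 0 < (1 + (I.level : ℝ)) ^ (1 - lam) / ε := by positivity
  have h := infinitePi_le_prod_mul_shift
    (fun I : DyadicInterval => laplace ((1 + (I.level : ℝ)) ^ (1 - lam) / ε)) δ
    (fun I => ENNReal.ofReal (Real.exp (|δ| / ((1 + (I.level : ℝ)) ^ (1 - lam) / ε))))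
    (fun _ => ENNReal.ofReal_ne_top)
    (fun I _ hS => laplace_le_exp_mul_preimage_add (hb I) δ hS) D hE
  refine h.trans ?_
  rw [← ENNReal.ofReal_prod_of_nonneg fun _ _ => (Real.exp_pos _).le, ← Real.exp_sum]
  refine mul_le_mul_left (ENNReal.ofReal_le_ofReal (Real.exp_le_exp.2 ?_)) _
  rw [Finset.sum_mul]
  refine Finset.sum_le_sum fun I _ => ?_
  calc |δ| / ((1 + (I.level : ℝ)) ^ (1 - lam) / ε)
      ≤ 1 / ((1 + (I.level : ℝ)) ^ (1 - lam) / ε) := by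
        have := hb I
        gcongr
    _ = _ := by rw [inv_noise_scale, mul_comm]

theorem sum_containing_shift (D : Finset DyadicInterval) (δ : ℝ) (z : DyadicInterval → ℝ)
    (t : ℕ) :
    ∑ I ∈ DyadicInterval.containing t, (if I ∈ D then z I + δ else z I) =
      ∑ I ∈ DyadicInterval.containing t, z I +
        ((D ∩ DyadicInterval.containing t).card : ℝ) * δ := by
  have h (I : DyadicInterval) :
      (if I ∈ D then z I + δ else z I) = z I + if I ∈ D then δ else 0 := by
    split_ifs <;> simp
  simp only [h]
  rw [Finset.sum_add_distrib, Finset.sum_ite_mem, Finset.sum_const, nsmul_eq_mul,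
    Finset.inter_comm]

theorem sum_update_Icc (x : ℕ → ℝ) (j : ℕ) (y : ℝ) (hj : 1 ≤ j) (n : ℕ) :
    ∑ i ∈ Finset.Icc 1 n, Function.update x j y i =
      ∑ i ∈ Finset.Icc 1 n, x i + if j ≤ n then y - x j else 0 := by
  have h (i : ℕ) : Function.update x j y i = x i + if i = j then y - x j else 0 := by
    split_ifs with hi
    · subst hi
      simp
    · simp [hi]
  simp only [h]
  rw [Finset.sum_add_distrib, Finset.sum_ite_eq']
  simp [hj]

theorem output_update_eq_output_shift (lam ε : ℝ) (x : ℕ → ℝ) {j B τ t : ℕ} (y : ℝ) (hj : 1 ≤ j)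
    {D : Finset DyadicInterval} (hD : DyadicInterval.Partitions D j (τ - B + 1)) (ht : t ≤ τ)
    (z : DyadicInterval → ℝ) :
    (countingAlgorithm lam B ε).output (Function.update x j y) z t =
      (countingAlgorithm lam B ε).output x
        (fun I => if I ∈ D then z I + (y - x j) else z I) t := by
  simp only [countingAlgorithm]
  split_ifs with h
  · rfl
  rw [sum_update_Icc x j y hj, sum_containing_shift, hD (t - B)]
  -- The intervals of `D` containing `t - B` number one or zero, exactly as the prefix up to `t - B`
  -- does or does not contain `j`.
  by_cases hjt : j ≤ t - B
  · rw [if_pos hjt, if_pos ⟨hjt, by omega⟩]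
    push_cast
    ring
  · rw [if_neg hjt, if_neg fun h => hjt h.1]
    push_cast
    ring

theorem isDPWithExpiration_countingAlgorithm {lam ε : ℝ} (hlam : 1 ≤ lam) (hε : 0 < ε) (B : ℕ) :
    IsDPWithExpiration (countingAlgorithm lam B ε) ε
      (expirationFn (2 * (2 * (Real.log 2)⁻¹) ^ lam) lam B) := by
  have hC : 0 ≤ 2 * (2 * (Real.log 2)⁻¹) ^ lam := by positivity
  refine ⟨expirationFn_nonneg hC lam B, expirationFn_monotone hC (by linarith) B, ?_⟩
  intro τ x j y hj hjτ hxy S hS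
  obtain ⟨D, hD, hDw⟩ : ∃ D : Finset DyadicInterval,
      DyadicInterval.Partitions D j (τ - B + 1) ∧
        ∑ I ∈ D, (1 + (I.level : ℝ)) ^ (lam - 1) ≤
          expirationFn (2 * (2 * (Real.log 2)⁻¹) ^ lam) lam B (τ - j) := by
    by_cases hd : τ - j < B
    -- Here `τ - B + 1 ≤ j`, also when `τ < B`: then `τ - B` truncates to `0` and `1 ≤ j`.
    · refine ⟨∅, fun t => ?_, by simp [expirationFn, hd]⟩
      rw [if_neg (by omega), Finset.empty_inter, Finset.card_empty]
    · have hN : τ - B + 1 - j = τ - j - B + 1 := by omega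
      obtain ⟨D, hD, hDw⟩ := DyadicInterval.exists_partitions_block
        (fun l => (1 + (l : ℝ)) ^ (lam - 1)) (fun l => by positivity)
        (Nat.log 2 (τ - j - B + 1) + 1) 0 j (τ - B + 1) hj (by omega)
        (by rw [hN]; exact Nat.lt_pow_succ_log_self (by norm_num) _)
      simp only [pow_zero, mul_one, zero_add] at hD hDw
      refine ⟨D, hD, hDw.trans ((sum_range_rpow_le hlam _).trans_eq ?_)⟩
      rw [expirationFn, if_neg hd]
      push_cast [Nat.cast_sub (not_lt.1 hd)]
      rfl
  have hE : MeasurableSet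
      {z | (fun i : Fin τ => (countingAlgorithm lam B ε).output x z (i + 1)) ∈ S} :=
    measurable_pi_lambda _
      (fun i : Fin τ => (countingAlgorithm lam B ε).measurable_output x (i + 1)) hS
  have hδ : |y - x j| ≤ 1 := by rwa [abs_sub_comm]
  refine (noiseLaw_le_exp_mul_shift hε lam hδ D hE).trans ?_
  have hset : {z : DyadicInterval → ℝ | (fun I => if I ∈ D then z I + (y - x j) else z I) ∈
        {z | (fun i : Fin τ => (countingAlgorithm lam B ε).output x z (i + 1)) ∈ S}} =
      {z | (fun i : Fin τ =>
        (countingAlgorithm lam B ε).output (Function.update x j y) z (i + 1)) ∈ S} := by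
    ext z
    simp only [Set.mem_ofPred_eq]
    congr! 2 with i
    exact (output_update_eq_output_shift lam ε x y hj hD i.2 z).symm
  rw [hset]
  refine mul_le_mul_left (ENNReal.ofReal_le_ofReal (Real.exp_le_exp.2 ?_)) _
  gcongr

/-! ### Error. -/

/-- By independence the moment factors; `1 ≤ lam` makes every scale at most `1 / ε`, so the rate `ε
/ 2` is admissible for each factor. -/
theorem lintegral_exp_sum_abs_noise_le {lam ε : ℝ} (hlam : 1 ≤ lam) (hε : 0 < ε)
    (F : Finset DyadicInterval) :
    ∫⁻ z, ENNReal.ofReal (Real.exp (ε / 2 * ∑ I ∈ F, |z I|)) ∂noiseLaw lam ε ≤ 2 ^ F.card := by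
  let μ (I : DyadicInterval) : Measure ℝ := laplace ((1 + (I.level : ℝ)) ^ (1 - lam) / ε)
  have hind : ProbabilityTheory.iIndepFun
      (fun (I : DyadicInterval) (z : DyadicInterval → ℝ) =>
        ENNReal.ofReal (Real.exp (ε / 2 * |z I|))) (noiseLaw lam ε) :=
    ProbabilityTheory.iIndepFun_infinitePi (P := μ)
      (X := fun _ x => ENNReal.ofReal (Real.exp (ε / 2 * |x|))) fun _ => by fun_prop
  have hprod (z : DyadicInterval → ℝ) : ENNReal.ofReal (Real.exp (ε / 2 * ∑ I ∈ F, |z I|)) =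
      ∏ I ∈ F, ENNReal.ofReal (Real.exp (ε / 2 * |z I|)) := by
    rw [Finset.mul_sum, Real.exp_sum, ENNReal.ofReal_prod_of_nonneg fun _ _ => (Real.exp_pos _).le]
  simp only [hprod]
  rw [ProbabilityTheory.lintegral_prod_eq_prod_lintegral_of_indepFun F _ hind
    fun I => by fun_prop]
  refine Finset.prod_le_pow_card _ _ _ fun I _ => ?_
  have hmap : (noiseLaw lam ε).map (fun z => z I) = μ I := Measure.infinitePi_map_eval μ I
  have hlint : ∫⁻ z, ENNReal.ofReal (Real.exp (ε / 2 * |z I|)) ∂noiseLaw lam ε =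
      ∫⁻ x, ENNReal.ofReal (Real.exp (ε / 2 * |x|)) ∂μ I := by
    rw [← hmap, lintegral_map (by fun_prop) (measurable_pi_apply I)]
  rw [hlint]
  refine lintegral_exp_mul_abs_laplace_le (by positivity) ?_
  have hone : (1 + (I.level : ℝ)) ^ (1 - lam) ≤ 1 :=
    Real.rpow_le_one_of_one_le_of_nonpos (by simp) (by linarith)
  have hpos : 0 < (1 + (I.level : ℝ)) ^ (1 - lam) := by positivity
  rw [div_le_div_iff₀ (by norm_num) (by positivity)]
  field_simp
  linarith

theorem noiseLaw_sum_abs_ge_le {lam ε : ℝ} (hlam : 1 ≤ lam) (hε : 0 < ε)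
    (F : Finset DyadicInterval) (R : ℝ) :
    noiseLaw lam ε {z | R / ε ≤ ∑ I ∈ F, |z I|} ≤
      ENNReal.ofReal (2 ^ F.card * Real.exp (-(R / 2))) := by
  have hmeas : Measurable fun z : DyadicInterval → ℝ =>
      ENNReal.ofReal (Real.exp (ε / 2 * ∑ I ∈ F, |z I|)) := by fun_prop
  have h1 := (mul_meas_ge_le_lintegral (μ := noiseLaw lam ε) hmeas
    (ENNReal.ofReal (Real.exp (R / 2)))).trans (lintegral_exp_sum_abs_noise_le hlam hε F)
  have hsub : {z : DyadicInterval → ℝ | R / ε ≤ ∑ I ∈ F, |z I|} ⊆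
      {z | ENNReal.ofReal (Real.exp (R / 2)) ≤
        ENNReal.ofReal (Real.exp (ε / 2 * ∑ I ∈ F, |z I|))} := by
    intro z hz
    refine ENNReal.ofReal_le_ofReal (Real.exp_le_exp.2 ?_)
    calc R / 2 = ε / 2 * (R / ε) := by field_simp
      _ ≤ _ := by gcongr; exact hz
  have h2 : ENNReal.ofReal (Real.exp (R / 2)) *
      noiseLaw lam ε {z | R / ε ≤ ∑ I ∈ F, |z I|} ≤ 2 ^ F.card :=
    (mul_le_mul_right (measure_mono hsub) _).trans h1
  calc noiseLaw lam ε {z | R / ε ≤ ∑ I ∈ F, |z I|}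
      = ENNReal.ofReal (Real.exp (-(R / 2))) * (ENNReal.ofReal (Real.exp (R / 2)) *
          noiseLaw lam ε {z | R / ε ≤ ∑ I ∈ F, |z I|}) := by
        rw [← mul_assoc, ← ENNReal.ofReal_mul (Real.exp_pos _).le, ← Real.exp_add,
          neg_add_cancel, Real.exp_zero, ENNReal.ofReal_one, one_mul]
    _ ≤ ENNReal.ofReal (Real.exp (-(R / 2))) * 2 ^ F.card := mul_le_mul_right h2 _
    _ = _ := by
        rw [mul_comm, ENNReal.ofReal_mul (by positivity), ENNReal.ofReal_pow (by norm_num),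
          ENNReal.ofReal_ofNat]

/-- With `R = 2 (c + 3) log T` the Chernoff factor is `T^(-c-3)`. The moment bound costs `2 T` and
the union bound `T`, which leaves `(2 / T) T^(-c)`, enough for `2 ≤ T`. -/
theorem noiseLaw_exists_containing_ge_le {lam ε c : ℝ} (hlam : 1 ≤ lam) (hε : 0 < ε)
    {T : ℕ} (hT : 2 ≤ T) :
    noiseLaw lam ε {z | ∃ t ∈ Finset.Icc 1 T,
        2 * (c + 3) * Real.log T / ε ≤ ∑ I ∈ DyadicInterval.containing t, |z I|} ≤
      ENNReal.ofReal (1 / (T : ℝ) ^ c) := by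
  have hTpos : (0 : ℝ) < T := by positivity
  have hset : {z : DyadicInterval → ℝ | ∃ t ∈ Finset.Icc 1 T,
        2 * (c + 3) * Real.log T / ε ≤ ∑ I ∈ DyadicInterval.containing t, |z I|} =
      ⋃ t ∈ Finset.Icc 1 T,
        {z | 2 * (c + 3) * Real.log T / ε ≤ ∑ I ∈ DyadicInterval.containing t, |z I|} := by
    ext z
    simp
  have hexp : Real.exp (-(2 * (c + 3) * Real.log T / 2)) = ((T : ℝ) ^ c * T ^ 3)⁻¹ := by
    rw [← Real.rpow_natCast, ← Real.rpow_add hTpos, ← Real.rpow_neg hTpos.le,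
      Real.rpow_def_of_pos hTpos]
    congr 1
    push_cast
    ring
  rw [hset]
  calc _ ≤ ∑ t ∈ Finset.Icc 1 T, noiseLaw lam ε
          {z | 2 * (c + 3) * Real.log T / ε ≤ ∑ I ∈ DyadicInterval.containing t, |z I|} :=
        measure_biUnion_finset_le _ _
    _ ≤ ∑ _t ∈ Finset.Icc 1 T, ENNReal.ofReal (2 * T * ((T : ℝ) ^ c * T ^ 3)⁻¹) := by
        refine Finset.sum_le_sum fun t ht => (noiseLaw_sum_abs_ge_le hlam hε _ _).trans ?_
        rw [hexp]
        refine ENNReal.ofReal_le_ofReal ?_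
        rw [Finset.mem_Icc] at ht
        have hcard : 2 ^ (DyadicInterval.containing t).card ≤ 2 * T :=
          calc 2 ^ (DyadicInterval.containing t).card ≤ 2 ^ (Nat.log 2 t + 1) :=
                Nat.pow_le_pow_right (by norm_num) (DyadicInterval.card_containing_le t)
            _ = 2 * 2 ^ Nat.log 2 t := by ring
            _ ≤ 2 * t := Nat.mul_le_mul_left _ (Nat.pow_log_le_self 2 (by omega))
            _ ≤ 2 * T := by omega
        gcongr
        exact_mod_cast hcard
    _ = ENNReal.ofReal (T * (2 * T * ((T : ℝ) ^ c * T ^ 3)⁻¹)) := by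
        rw [Finset.sum_const, Nat.card_Icc, nsmul_eq_mul, ENNReal.ofReal_mul hTpos.le,
          ENNReal.ofReal_natCast, Nat.add_sub_cancel]
    _ ≤ _ := by
        refine ENNReal.ofReal_le_ofReal ?_
        have hc : 0 < (T : ℝ) ^ c := by positivity
        have h2 : (2 : ℝ) ≤ T := by exact_mod_cast hT
        calc (T : ℝ) * (2 * T * ((T : ℝ) ^ c * T ^ 3)⁻¹) = 2 / T * (1 / (T : ℝ) ^ c) := by
              field_simp
          _ ≤ 1 * (1 / (T : ℝ) ^ c) := by
              gcongr
              exact (div_le_one hTpos).2 h2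
          _ = _ := one_mul _

theorem abs_output_sub_sum_le {lam ε : ℝ} {B T : ℕ} {x : ℕ → ℝ}
    (hx : ∀ i ∈ Finset.Icc 1 T, x i ∈ Set.Icc (0 : ℝ) 1) {t : ℕ} (ht : t ≤ T)
    (z : DyadicInterval → ℝ) {M : ℝ} (hM : 0 ≤ M)
    (hz : B < t → ∑ I ∈ DyadicInterval.containing (t - B), |z I| ≤ M) :
    |(countingAlgorithm lam B ε).output x z t - ∑ i ∈ Finset.Icc 1 t, x i| ≤ B + M := by
  have hsum (s : Finset ℕ) (hs : s ⊆ Finset.Icc 1 T) : |∑ i ∈ s, x i| ≤ s.card := by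
    refine (Finset.abs_sum_le_sum_abs _ _).trans ?_
    rw [← nsmul_one, ← Finset.sum_const]
    refine Finset.sum_le_sum fun i hi => ?_
    rw [abs_of_nonneg (hx i (hs hi)).1]
    exact (hx i (hs hi)).2
  simp only [countingAlgorithm]
  split_ifs with h
  · rw [zero_sub, abs_neg]
    have h1 := hsum (Finset.Icc 1 t) (Finset.Icc_subset_Icc_right ht)
    have h2 : (t : ℝ) ≤ B := by exact_mod_cast h
    rw [Nat.card_Icc, Nat.add_sub_cancel] at h1
    linarith
  · have hsub : Finset.Icc 1 (t - B) ⊆ Finset.Icc 1 t := Finset.Icc_subset_Icc_right (by omega)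
    have h1 := hsum (Finset.Icc 1 t \ Finset.Icc 1 (t - B))
      (Finset.sdiff_subset.trans (Finset.Icc_subset_Icc_right ht))
    rw [Finset.card_sdiff_of_subset hsub, Nat.card_Icc, Nat.card_Icc,
      show t + 1 - 1 - (t - B + 1 - 1) = B by omega] at h1
    rw [← Finset.sum_sdiff hsub]
    have h2 := (Finset.abs_sum_le_sum_abs z (DyadicInterval.containing (t - B))).trans
      (hz (not_le.1 h))
    calc _ = |∑ I ∈ DyadicInterval.containing (t - B), z I -
            ∑ i ∈ Finset.Icc 1 t \ Finset.Icc 1 (t - B), x i| := by congr 1; ring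
      _ ≤ _ := (abs_sub _ _).trans (by linarith)

theorem error_countingAlgorithm {a c lam ε : ℝ} (hc : 0 < c) (hlam : 1 ≤ lam) (hε : 0 < ε)
    {T : ℕ} (hT : 1 ≤ T) {B : ℕ} (hB : (B : ℝ) ≤ a * (Real.log T / ε)) {x : ℕ → ℝ}
    (hx : ∀ i ∈ Finset.Icc 1 T, x i ∈ Set.Icc (0 : ℝ) 1) :
    ENNReal.ofReal (1 - 1 / (T : ℝ) ^ c) ≤
      (countingAlgorithm lam B ε).coins
        {z | ∀ t ∈ Finset.Icc 1 T,
          |(countingAlgorithm lam B ε).output x z t - ∑ i ∈ Finset.Icc 1 t, x i| ≤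
            (|a| + 2 * (c + 3)) * (Real.log T / ε)} := by
  rcases hT.eq_or_lt with rfl | hT2
  -- For `T = 1` the required probability is `0`.
  · simp
  have hM : 0 ≤ 2 * (c + 3) * Real.log T / ε := by
    have := Real.log_natCast_nonneg T
    positivity
  have hB' : (B : ℝ) ≤ |a| * (Real.log T / ε) := by
    have := Real.log_natCast_nonneg T
    exact hB.trans (mul_le_mul_of_nonneg_right (le_abs_self a) (by positivity))
  -- A cover and subadditivity replace complements, so no measurability of the events is needed.
  have hcover : (Set.univ : Set (DyadicInterval → ℝ)) ⊆
      {z | ∀ t ∈ Finset.Icc 1 T,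
          |(countingAlgorithm lam B ε).output x z t - ∑ i ∈ Finset.Icc 1 t, x i| ≤
            (|a| + 2 * (c + 3)) * (Real.log T / ε)} ∪
      {z | ∃ t ∈ Finset.Icc 1 T,
        2 * (c + 3) * Real.log T / ε ≤ ∑ I ∈ DyadicInterval.containing t, |z I|} := by
    intro z _
    refine or_iff_not_imp_right.2 fun hz t ht => ?_
    rw [Finset.mem_Icc] at ht
    refine (abs_output_sub_sum_le hx ht.2 z hM fun hBt => ?_).trans ?_
    · by_contra hcon
      exact hz ⟨t - B, Finset.mem_Icc.2 ⟨by omega, by omega⟩, (not_le.1 hcon).le⟩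
    · rw [add_mul, ← mul_div_assoc (2 * (c + 3))]
      linarith
  have hone : 1 ≤ noiseLaw lam ε _ + noiseLaw lam ε _ :=
    calc (1 : ENNReal) = (countingAlgorithm lam B ε).coins Set.univ :=
          (countingAlgorithm lam B ε).isProbabilityMeasure_coins.measure_univ.symm
      _ ≤ _ := (measure_mono hcover).trans (measure_union_le _ _)
  rw [ENNReal.ofReal_sub _ (by positivity), ENNReal.ofReal_one, tsub_le_iff_right]
  exact hone.trans (add_le_add_right (noiseLaw_exists_containing_ge_le hlam hε hT2) _)

theorem corollary2 :
    -- error: `K` depends only on the constant `a` in `B = O(log(T)/ε)` and on `c`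
    (∀ a c : ℝ, 0 < c → ∃ K : ℝ, 0 < K ∧
      ∀ lam : ℝ, 1 ≤ lam → ∀ ε : ℝ, 0 < ε → ∀ T : ℕ, 1 ≤ T →
      ∀ B : ℕ, (B : ℝ) ≤ a * (Real.log T / ε) →
      ∀ x : ℕ → ℝ, (∀ i ∈ Finset.Icc 1 T, x i ∈ Set.Icc (0 : ℝ) 1) →
        ENNReal.ofReal (1 - 1 / (T : ℝ) ^ c) ≤
          (countingAlgorithm lam B ε).coins
            {z | ∀ t ∈ Finset.Icc 1 T,
              |(countingAlgorithm lam B ε).output x z t - ∑ i ∈ Finset.Icc 1 t, x i| ≤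
                K * (Real.log T / ε)}) ∧
    -- privacy: `C` depends only on `lam`
    (∀ lam : ℝ, 1 ≤ lam → ∃ C : ℝ, 0 < C ∧ ∀ ε : ℝ, 0 < ε → ∀ B : ℕ,
      IsDPWithExpiration (countingAlgorithm lam B ε) ε (expirationFn C lam B)) := by
  -- `|a|` pays for the delay, with the absolute value keeping `K` positive for negative `a`; `2 *
  -- (c + 3)` pays for the noise.
  refine ⟨fun a c hc => ⟨|a| + 2 * (c + 3), by positivity, ?_⟩, fun lam hlam =>
    ⟨2 * (2 * (Real.log 2)⁻¹) ^ lam, ?_, fun ε hε B =>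
      isDPWithExpiration_countingAlgorithm hlam hε B⟩⟩
  · intro lam hlam ε hε T hT B hB x hx
    exact error_countingAlgorithm hc hlam hε hT hB hx
  · have : 0 < Real.log 2 := Real.log_pos (by norm_num)
    positivity
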